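/- Let $k,\ell\ge 2$ be multiplicatively independent integers (i.e. $k^a=\ell^b$ with $a,b\in\mathbb N$ implies $a=b=0$) and put $L=\{k,\ell\}$. Let $M$ be an ordered abelian group with a distinguished element $1$, and let $A_k,A_\ell\subseteq M$. Identify $z\in\mathbb Z$ with $z\cdot 1\in M$, and for $n\ge 1$ let $D_n(x)$ abbreviate $\exists y\,(x=ny)$. Assume $(M,A_k,A_\ell)\models T_\forall(\{k,\ell\})$, that is: 1. (congruence) for all $n\ge 2$ and $x\in M$ there is $j\in\{1,\dots,n\}$ such that $\neg D_n(x+i)$ for all $i\in\{1,\dots,n\}$, $i\ne j$; 2. for $b\in L$: $1\in A_b$, and $x\in A_b\iff bx\in A_b$ for all $x\in M$; 3. (discreteness) $0<1$, and $x\le 0$ or $x\ge 1$ for all $x\in M$; 4. (Mann axioms) let $x_i\in A_{b_i}$ with $b_i\in L$ $(1\le i\le p)$ satisfy $\sum_i c_ix_i=g$ with non-zero integers $c_i$ and $g\in\mathbb Z$, and suppose that no proper non-empty subsum $\sum_{i\in S}c_ix_i$ vanishes. If $g\neq 0$, then $x_i\in b_i^{\mathbb N}$ for all $i$. If $g=0$,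 then either $x_i\in b_i^{\mathbb N}$ for all $i$, or all $b_i$ are equal to one $b\in L$ and for all $i,j$ there are $s,t\in\mathbb N$ with $b^sx_i=b^tx_j$; 5. (basic inequality axioms) for $b\in L$ and $x\in A_b$: $x>0$, and no $y\in A_b$ satisfies $x<y<bx$; 6. (Carmichael axioms) for all $d\ge 1$, $e\ge 0$, $b_1,\dots,b_p\in L$ and $x_i\in A_{b_i}\setminus\{1,b_i,\dots,b_i^{e-1}\}$ there are exponents $e\le s_i<e+d$ such that for all $c_1,\dots,c_p,g\in\mathbb Z$ with $d\nmid \sum_i c_ib_i^{s_i}+g$ one has $\neg D_d(\sum_i c_ix_i+g)$. The congruence type $d_M(\gamma)$ of a tuple $\gamma=(\gamma_1,\dots,\gamma_q)$ in $M$ is the set of all conditions $D_N(c_1z_1+\dots+c_qz_q+g)$, with $N\ge1$ and $c_1,\dots,c_q,g\in\mathbb Z$, in variables $z_1,\dots,z_q$, that hold in $M$ at $z=\gamma$. Let $r,m,n\ge 0$, let $C\in\mathbb Q^{r\times(m+n)}$, and let $\alpha\in(A_k\setminus\mathbb Z)^m$ and $\alpha'\in(A_\ell\setminus\mathbb Z)^n$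 be such that every coordinate of $C(\alpha,\alpha')$ is positive (computed in the divisible hull $\mathbb Q\otimes M$ of $M$). Let $\Delta(x_1,\dots,x_m,y_1,\dots,y_n)\subseteq d_M(\alpha,\alpha')$ be finite. Then there exist $u\in(k^{\mathbb N})^m$ and $v\in(\ell^{\mathbb N})^n$ such that every coordinate of $C(u,v)$ is positive and $(u,v)$ satisfies $\Delta$ in $\mathbb Z$. -/

import Mathlib

namespace PowerTheory

/-- The formula `D_n(x)`, i.e. `∃ y, x = n y`. -/
def D {M : Type*} [AddCommGroup M] (n : ℕ) (x : M) : Prop :=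
  ∃ y : M, x = n • y

/-- Mann axioms for the predicates `A ℓ`, `ℓ ∈ L`: consider a nondegenerate solution `x` (no
vanishing proper nonempty subsum) of a linear equation `∑ cᵢ xᵢ = g` with nonzero integer
coefficients `cᵢ` and `xᵢ ∈ A (bᵢ)`.
* If `g ≠ 0`, then `x` is one of the standard solutions `(bᵢ ^ sᵢ)ᵢ`.
* If `g = 0`, then `x` is standard, or all the `bᵢ` are the same `ℓ`, and the `xᵢ` agree up to
  multiplication by standard powers of `ℓ`.
As such equations have only finitely many nondegenerate solutions in powers (up to scaling, in the
homogeneous case with a single base), every instance amounts to a universal first-order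
sentence. -/
structure MannAxioms {M : Type*} [AddCommGroup M] [One M] (L : Set ℕ) (A : ℕ → Set M) : Prop where
  inhomogeneous : ∀ (p : ℕ) (b : Fin p → ℕ) (c : Fin p → ℤ) (g : ℤ) (x : Fin p → M),
    (∀ i, b i ∈ L) → (∀ i, c i ≠ 0) → g ≠ 0 → (∀ i, x i ∈ A (b i)) →
    (∑ i, c i • x i) = g • (1 : M) →
    (∀ S : Finset (Fin p), S.Nonempty → (∑ i ∈ S, c i • x i) ≠ 0) →
    ∃ s : Fin p → ℕ, ∀ i, x i = (b i ^ s i) • (1 : M)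
  homogeneous : ∀ (p : ℕ) (b : Fin p → ℕ) (c : Fin p → ℤ) (x : Fin p → M),
    (∀ i, b i ∈ L) → (∀ i, c i ≠ 0) → (∀ i, x i ∈ A (b i)) →
    (∑ i, c i • x i) = 0 →
    (∀ S : Finset (Fin p), S.Nonempty → S ≠ Finset.univ → (∑ i ∈ S, c i • x i) ≠ 0) →
    (∃ s : Fin p → ℕ, ∀ i, x i = (b i ^ s i) • (1 : M)) ∨
    (∃ ℓ ∈ L, (∀ i, b i = ℓ) ∧ ∀ i j, ∃ s t : ℕ, (ℓ ^ s) • x i = (ℓ ^ t) • x j)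

/-- Basic inequality axioms: elements of `A ℓ` are positive, and there is no element of `A ℓ`
strictly between `x` and `ℓ x` when `x ∈ A ℓ`. -/
def BasicInequalityAxioms {M : Type*} [AddCommGroup M] [LinearOrder M]
    (L : Set ℕ) (A : ℕ → Set M) : Prop :=
  ∀ ℓ ∈ L, ∀ x ∈ A ℓ, 0 < x ∧ ∀ y ∈ A ℓ, ¬ (x < y ∧ y < ℓ • x)

/-- Carmichael axioms, in universal form: modulo every `d ≥ 1`, elements `xᵢ ∈ A (bᵢ)` behave like
standard powers `bᵢ ^ sᵢ`, with exponents `sᵢ ≥ e` if none of the `xᵢ` is among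
`1, bᵢ, …, bᵢ ^ (e - 1)`. Here "`xᵢ` behaves like `bᵢ ^ sᵢ`" is expressed by negated divisibility
only (in the style of the universal congruence axioms): `D_d` fails for every combination
`∑ cᵢ xᵢ + g` such that `d` does not divide `∑ cᵢ bᵢ ^ sᵢ + g`. Since
`(bᵢ ^ s mod d)_{s ≥ e}` takes all its values for `e ≤ s < e + d`, and `c`, `g` only matter
modulo `d`, every instance is a universal first-order sentence. -/
def CarmichaelAxioms {M : Type*} [AddCommGroup M] [One M] (L : Set ℕ) (A : ℕ → Set M) : Prop :=
  ∀ (d e p : ℕ), 1 ≤ d → ∀ (b : Fin p → ℕ) (x : Fin p → M),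
    (∀ i, b i ∈ L) → (∀ i, x i ∈ A (b i)) →
    (∀ i, ∀ j < e, x i ≠ (b i ^ j) • (1 : M)) →
    ∃ s : Fin p → ℕ, (∀ i, e ≤ s i ∧ s i < e + d) ∧
      ∀ (c : Fin p → ℤ) (g : ℤ), ¬ ((d : ℤ) ∣ (∑ i, c i * (b i : ℤ) ^ s i) + g) →
        ¬ D d ((∑ i, c i • x i) + g • (1 : M))

/-- `(M, (A ℓ)_{ℓ ∈ L}) ⊨ T_∀(L)`, for a set `L` of at most two integers `≥ 2`. The axioms of
ordered abelian groups are the type class assumptions on `M`. -/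
structure ModelsUniversalTheory {M : Type*} [AddCommGroup M] [LinearOrder M]
    [IsOrderedAddMonoid M] [One M] (L : Set ℕ) (A : ℕ → Set M) : Prop where
  congruence : ∀ n : ℕ, 2 ≤ n → ∀ x : M, ∃ j ∈ Finset.Icc 1 n, ∀ k ∈ Finset.Icc 1 n,
    k ≠ j → ¬ D n (x + k • (1 : M))
  one_mem : ∀ ℓ ∈ L, (1 : M) ∈ A ℓ
  mul_mem_iff : ∀ ℓ ∈ L, ∀ x : M, x ∈ A ℓ ↔ ℓ • x ∈ A ℓ
  zero_lt_one : (0 : M) < 1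
  discrete : ∀ x : M, x ≤ 0 ∨ 1 ≤ x
  mann : MannAxioms L A
  basicInequality : BasicInequalityAxioms L A
  carmichael : CarmichaelAxioms L A

/-- A divisibility condition `D_n(∑ cᵢ xᵢ + g)` in the variables `xᵢ`, with `n ≥ 1` and integers
`cᵢ`, `g`. -/
structure DivCond (ι : Type*) where
  modulus : ℕ
  modulus_pos : 0 < modulus
  coeff : ι → ℤ
  const : ℤ

/-- The divisibility condition `φ` is satisfied by the tuple `x` in `M`. -/
def DivCond.Holds {ι M : Type*} [Fintype ι] [AddCommGroup M] [One M]
    (φ : DivCond ι) (x : ι → M) : Prop :=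
  D φ.modulus ((∑ i, φ.coeff i • x i) + φ.const • (1 : M))

/-- The congruence type `d_M(x)`: all divisibility conditions satisfied by `x` in `M`. -/
def congruenceType {ι M : Type*} [Fintype ι] [AddCommGroup M] [One M] (x : ι → M) :
    Set (DivCond ι) :=
  {φ | φ.Holds x}

/-- The system `C x > 0` for a rational matrix `C` and a tuple `x` in an ordered abelian group `M`,
evaluated in the divisible hull of `M` (an ordered `ℚ`-vector space). -/
def SolvesStrict {ι κ M : Type*} [Fintype ι] [AddCommGroup M] [LinearOrder M]
    [IsOrderedAddMonoid M] (C : Matrix κ ι ℚ) (x : ι → M) : Prop :=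
  ∀ a, 0 < ∑ i, C a i • (x i : DivisibleHull M)

end PowerTheory

/-!
All the conditions to be met are strict inequalities and divisibilities, so a solution in powers can
be obtained by approximation; no equation has to be preserved.

*Divisibilities.* By the basic inequality axioms, two elements of `A b` either differ by a factor
`b ^ e` or lie in distinct Archimedean classes (`eq_pow_smul_or_nsmul_lt`), so every given element
is a power of its base times one of finitely many representatives, and representatives with the
same base have distinct Archimedean classes. For a common modulus `d`, the Carmichael axioms provide
exponents `s i` such that every divisibility by `d` between the representatives also holds between
the powers `b ^ s i`. As the elements are nonstandard, `s i` may be taken in the range where powers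
are periodic modulo `d`, with some period `P`. Thus all the exponents `s i + P * σ i` satisfy the
divisibilities, and only the inequalities remain to be met, by the choice of the `σ i`.

*Inequalities.* This is `exists_scaled_powers`: finitely many linear forms that are positive at the
elements `v i` of an ordered `ℚ`-vector space, each `v i` labelled with one of two bases, are also
positive at `θ * b ^ σ i` for suitable `σ i`, where `θ > 0` is real and depends only on the base
`b`. The proof is by induction on the number of elements, and treats those in the top Archimedean
class, of which there are at most two.
* If the largest element is alone in its class, its exponent is chosen last, and very large.
* Otherwise the top class contains `x` and `y`, with different bases. Let `ρ` be the standard part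
  of `x / y`. A form whose leading part `c x + d y` has `c ρ + d > 0` is positive once the powers
  for `x` and `y` are large and their ratio is close to `ρ`. The other forms depend on `x` and `y`
  only through `z = x - ρ y`. Eliminating `z` à la Fourier–Motzkin gives a system in fewer elements.
  The induction hypothesis solves it in scaled powers, hence yields a real value `z₀` for `z`. As
  the ratios of powers of the two bases are dense in the positive reals, large powers can be chosen
  such that `x - ρ y` becomes `z₀` exactly after an arbitrarily small change of the scaling `θ` of
  one base.

Density also lets the factors `θ` be replaced by powers, which gives `exists_powers`.
-/

namespace PowerTheory

open Filter Topology

/-! ### Density of the ratios of powers -/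

/-- Large natural multiples of `a` and `b` have differences close to any given real number. -/
theorem exists_large_approx {a b : ℝ} (ha : 0 < a) (hb : 0 < b) (hab : Irrational (a / b))
    (x ε : ℝ) (hε : 0 < ε) (N : ℕ) :
    ∃ D E : ℕ, N ≤ D ∧ N ≤ E ∧ |E * b - D * a - x| < ε := by
  have : Fact (0 < b) := ⟨hb⟩
  -- natural multiples of `a` come back to every point of the circle `ℝ / bℤ` infinitely often
  have hdense : DenseRange (· • (a : AddCircle b) : ℤ → AddCircle b) :=
    AddCircle.denseRange_zsmul_coe_iff.2 hab
  have hcl : MapClusterPt ((-x : ℝ) : AddCircle b) atTop (· • (a : AddCircle b) : ℕ → AddCircle b) :=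
    ((mapClusterPt_atTop_nsmul_tfae _ _).out 0 3).2 (hdense _)
  have hnhds : ((↑) : ℝ → AddCircle b) '' Metric.ball (-x) ε ∈ 𝓝 ((-x : ℝ) : AddCircle b) :=
    (QuotientAddGroup.isOpenMap_coe _ Metric.isOpen_ball).mem_nhds
      ⟨-x, Metric.mem_ball_self hε, rfl⟩
  have hfreq := mapClusterPt_iff_frequently.1 hcl _ hnhds
  -- `D ≥ N'` forces the multiple of `b` close to `D * a + x` to exceed `N * b`
  obtain ⟨N', hN'⟩ := exists_nat_gt ((N * b - x + ε) / a)
  obtain ⟨D, ⟨y, hy, hDy⟩, hD⟩ := (hfreq.and_eventually (eventually_ge_atTop (max N N'))).exists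
  have h1 : (((D : ℝ) * a - y : ℝ) : AddCircle b) = 0 := by
    rw [AddCircle.coe_sub, sub_eq_zero, hDy, ← nsmul_eq_mul, AddCircle.coe_nsmul]
  obtain ⟨e, he⟩ := (AddCircle.coe_eq_zero_iff b).1 h1
  rw [zsmul_eq_mul] at he
  rw [Metric.mem_ball, Real.dist_eq, abs_lt] at hy
  have hN'D : (N' : ℝ) ≤ D := by exact_mod_cast (le_max_right _ _).trans hD
  rw [div_lt_iff₀ ha] at hN'
  have h2 : (N : ℝ) < e := by
    have : (N : ℝ) * b < e * b := by nlinarith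
    exact lt_of_mul_lt_mul_right this hb.le
  have h3 : (N : ℤ) < e := by exact_mod_cast h2
  lift e to ℕ using by omega
  refine ⟨D, e, (le_max_left _ _).trans hD, by omega, ?_⟩
  push_cast at he
  rw [he, abs_lt]
  constructor <;> linarith

theorem exists_tendsto_pow_div_pow {K L : ℝ} (hK : 1 < K) (hL : 1 < L)
    (h : Irrational (Real.log K / Real.log L)) {r : ℝ} (hr : 0 < r) :
    ∃ D E : ℕ → ℕ, Tendsto D atTop atTop ∧ Tendsto E atTop atTop ∧
      Tendsto (fun n => L ^ E n / K ^ D n) atTop (𝓝 r) := by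
  choose D E hD hE hDE using fun n : ℕ => exists_large_approx (Real.log_pos hK) (Real.log_pos hL) h
    (Real.log r) (1 / ((n : ℝ) + 1)) Nat.one_div_pos_of_nat n
  refine ⟨D, E, tendsto_atTop_mono hD tendsto_id, tendsto_atTop_mono hE tendsto_id, ?_⟩
  have h1 : Tendsto (fun n => E n * Real.log L - D n * Real.log K) atTop (𝓝 (Real.log r)) := by
    rw [tendsto_iff_dist_tendsto_zero]
    exact squeeze_zero (fun _ => dist_nonneg) (fun n => (hDE n).le)
      tendsto_one_div_add_atTop_nhds_zero_nat
  have h2 := (Real.continuous_exp.tendsto _).comp h1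
  rw [Real.exp_log hr] at h2
  refine h2.congr fun n => ?_
  have hK0 : 0 < K := by linarith
  have hL0 : 0 < L := by linarith
  simp only [Function.comp_apply]
  rw [Real.exp_sub, ← Real.log_pow, ← Real.log_pow, Real.exp_log (pow_pos hL0 _),
    Real.exp_log (pow_pos hK0 _)]

/-! ### Leading terms in an ordered vector space -/

section Leading

variable {V : Type*} [AddCommGroup V] [LinearOrder V] [IsOrderedAddMonoid V] [Module ℚ V]
  [IsStrictOrderedModule ℚ V]

theorem nonneg_of_pos_smul_add {x g : V} (hx : 0 < x)
    (hg : ArchimedeanClass.mk x < ArchimedeanClass.mk g) {c : ℚ} (h : 0 < c • x + g) : 0 ≤ c := by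
  by_contra! hc
  have h1 : (-c) • x ≤ g := by
    rw [neg_smul, neg_le_iff_add_nonneg]
    simpa [add_comm] using h.le
  have h2 : 0 ≤ (-c) • x := smul_nonneg (by linarith) hx.le
  have h3 := ArchimedeanClass.mk_antitoneOn (Set.mem_Ici.2 h2) (Set.mem_Ici.2 (h2.trans h1)) h1
  rw [ArchimedeanClass.mk_smul _ (by linarith : (-c) ≠ 0)] at h3
  exact absurd hg (not_lt.2 h3)

/-- The witness `ρ` is the standard part of the ratio `x / y`, and `c ρ + d` is the leading
coefficient, relative to `y`, of `c x + d y + g`, where `g` is infinitesimal relative to `y`. -/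
theorem exists_leading_ratio {x y : V} (hx : 0 < x) (hy : 0 < y)
    (hxy : ArchimedeanClass.mk x = ArchimedeanClass.mk y) :
    ∃ ρ : ℝ, 0 < ρ ∧ ∀ (c d : ℚ) (g : V), ArchimedeanClass.mk y < ArchimedeanClass.mk g →
      0 < c • x + d • y + g → 0 ≤ c * ρ + d := by
  obtain ⟨⟨m, hm⟩, n, hn⟩ := ArchimedeanClass.mk_eq_mk.1 hxy
  rw [abs_of_pos hx, abs_of_pos hy] at hm hn
  set T : Set ℝ := {t | ∃ p : ℚ, t = p ∧ p • y ≤ x} with hT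
  have hbdd : BddAbove T := by
    refine ⟨n, ?_⟩
    rintro _ ⟨p, rfl, hp⟩
    have h1 : p • y ≤ (n : ℚ) • y := by
      rw [Nat.cast_smul_eq_nsmul]; exact hp.trans hn
    exact_mod_cast le_of_smul_le_smul_of_pos_right h1 hy
  have hm0 : 0 < m := by
    rcases Nat.eq_zero_or_pos m with rfl | h
    · simp at hm; exact absurd hy (not_lt.2 hm)
    · exact h
  have hmT : (1 / m : ℝ) ∈ T := by
    refine ⟨1 / m, by simp, ?_⟩
    have hm' : (0 : ℚ) < m := by exact_mod_cast hm0
    rw [← smul_le_smul_iff_of_pos_left hm', smul_smul, mul_one_div_cancel hm'.ne', one_smul,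
      Nat.cast_smul_eq_nsmul]
    exact hm
  have hlt : ∀ p : ℚ, (p : ℝ) < sSup T → p • y ≤ x := by
    intro p hp
    obtain ⟨_, ⟨q, rfl, hq⟩, hpq⟩ := exists_lt_of_lt_csSup ⟨_, hmT⟩ hp
    have : p ≤ q := by exact_mod_cast hpq.le
    exact (smul_le_smul_of_nonneg_right this hy.le).trans hq
  have hgt : ∀ p : ℚ, sSup T < p → x ≤ p • y := by
    intro p hp
    by_contra! h
    exact absurd (le_csSup hbdd ⟨p, rfl, h.le⟩) (not_le.2 hp)
  refine ⟨sSup T, lt_of_lt_of_le (by positivity) (le_csSup hbdd hmT), fun c d g hg hpos => ?_⟩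
  by_contra! hneg
  -- a rational `p` near `ρ` bounds `c x + d y` by a negative multiple of `y`
  obtain ⟨p, hp, hcp⟩ : ∃ p : ℚ, c * p + d < 0 ∧ c • x ≤ (c * p) • y := by
    rcases lt_trichotomy c 0 with hc | hc | hc
    · have hc' : (c : ℝ) < 0 := by exact_mod_cast hc
      have : (-d / c : ℝ) < sSup T := by rw [div_lt_iff_of_neg hc']; linarith
      obtain ⟨p, h1, h2⟩ := exists_rat_btwn this
      rw [div_lt_iff_of_neg hc'] at h1
      refine ⟨p, ?_, ?_⟩
      · have : ((c * p + d : ℚ) : ℝ) < 0 := by push_cast; linarith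
        exact_mod_cast this
      · rw [mul_smul]; exact smul_le_smul_of_nonpos_left (hlt p h2) hc.le
    · refine ⟨0, ?_, by simp [hc]⟩
      subst hc
      have : (d : ℝ) < 0 := by simpa using hneg
      simpa using (by exact_mod_cast this : d < 0)
    · have hc' : (0 : ℝ) < c := by exact_mod_cast hc
      have : sSup T < (-d / c : ℝ) := by rw [lt_div_iff₀ hc']; linarith
      obtain ⟨p, h1, h2⟩ := exists_rat_btwn this
      rw [lt_div_iff₀ hc'] at h2
      refine ⟨p, ?_, ?_⟩
      · have : ((c * p + d : ℚ) : ℝ) < 0 := by push_cast; linarith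
        exact_mod_cast this
      · rw [mul_smul]; exact smul_le_smul_of_nonneg_left (hgt p h1) hc.le
  refine absurd (nonneg_of_pos_smul_add hy hg (c := c * p + d) ?_) (not_le.2 hp)
  rw [add_smul]
  refine hpos.trans_le ?_
  gcongr

theorem mk_lt_mk_sum {ι : Type*} {x : V} (hx : x ≠ 0) (S : Finset ι) (f : ι → ℚ) (v : ι → V)
    (h : ∀ i ∈ S, ArchimedeanClass.mk x < ArchimedeanClass.mk (v i)) :
    ArchimedeanClass.mk x < ArchimedeanClass.mk (∑ i ∈ S, f i • v i) := by
  have hx' : ArchimedeanClass.mk x ≠ ⊤ := by simpa using hx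
  rw [← ArchimedeanClass.mem_ballAddSubgroup_iff hx']
  refine sum_mem fun i hi => ?_
  rw [ArchimedeanClass.mem_ballAddSubgroup_iff hx']
  exact (h i hi).trans_le (ArchimedeanClass.mk_le_mk_smul _ _)

end Leading

/-! ### Elimination of a variable -/

/-- Fourier–Motzkin elimination of the variable `x` from the linear system `f > 0`, `f ∈ F`: the
forms in `F` not involving `x`, and the positive combinations of two forms in `F` in which `x`
cancels. A linear form is given by its coefficients. -/
def eliminate {ι : Type*} (F : Set (ι → ℚ)) (x : ι) : Set (ι → ℚ) :=
  {f | f ∈ F ∧ f x = 0} ∪ {h | ∃ f ∈ F, ∃ g ∈ F, 0 < f x ∧ g x < 0 ∧ h = (-g x) • f + f x • g}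

theorem eliminate_finite {ι : Type*} {F : Set (ι → ℚ)} (hF : F.Finite) (x : ι) :
    (eliminate F x).Finite := by
  refine (hF.subset fun f hf => hf.1).union ?_
  refine (Set.Finite.image2 (fun f g => (-g x) • f + f x • g) hF hF).subset ?_
  rintro h ⟨f, hf, g, hg, -, -, rfl⟩
  exact ⟨f, hf, g, hg, rfl⟩

/-- Soundness of the elimination, with the value `z` for the eliminated variable. -/
theorem eliminate_pos {ι V : Type*} [AddCommGroup V] [LinearOrder V] [IsOrderedAddMonoid V]
    [Module ℚ V] [IsStrictOrderedModule ℚ V] {F : Set (ι → ℚ)} {x : ι} {S : Finset ι} {v : ι → V}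
    {z : V} (hF : ∀ f ∈ F, 0 < f x • z + ∑ i ∈ S, f i • v i) {f : ι → ℚ}
    (hf : f ∈ eliminate F x) : 0 < ∑ i ∈ S, f i • v i := by
  rcases hf with ⟨hf, hfx⟩ | ⟨f, hf, g, hg, hfx, hgx, rfl⟩
  · simpa [hfx] using hF f hf
  · have h1 := smul_pos (neg_pos.2 hgx) (hF f hf)
    have h2 := smul_pos hfx (hF g hg)
    have h3 := add_pos h1 h2
    convert h3 using 1
    simp only [Pi.add_apply, Pi.smul_apply, smul_eq_mul, add_smul, mul_smul,
      Finset.sum_add_distrib, smul_add, ← Finset.smul_sum, neg_smul,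
      Pi.neg_apply, Finset.sum_neg_distrib]
    rw [smul_comm (g x) (f x) z]
    abel

/-- Completeness of the elimination over `ℝ`: the eliminated variable lies above finitely many lower
bounds and below finitely many upper bounds, which the eliminated system makes compatible. -/
theorem exists_of_eliminate_pos {ι : Type*} {F : Set (ι → ℚ)} (hfin : F.Finite) {x : ι}
    {S : Finset ι} {v : ι → ℝ} (hF : ∀ f ∈ eliminate F x, 0 < ∑ i ∈ S, f i * v i) :
    ∃ z : ℝ, ∀ f ∈ F, 0 < f x * z + ∑ i ∈ S, f i * v i := by
  classical
  set G := hfin.toFinset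
  set t : (ι → ℚ) → ℝ := fun f => -(∑ i ∈ S, f i * v i) / f x with ht
  obtain ⟨z, hlo, hhi⟩ := Order.exists_between_finsets ((G.filter fun f => 0 < f x).image t)
    ((G.filter fun f => f x < 0).image t) (by
      simp only [Finset.mem_image, Finset.mem_filter]
      rintro _ ⟨f, ⟨hf, hfx⟩, rfl⟩ _ ⟨g, ⟨hg, hgx⟩, rfl⟩
      have h := hF _ (Or.inr ⟨f, hfin.mem_toFinset.1 hf, g, hfin.mem_toFinset.1 hg, hfx, hgx, rfl⟩)
      have hfx' : (0 : ℝ) < f x := by exact_mod_cast hfx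
      have hgx' : (g x : ℝ) < 0 := by exact_mod_cast hgx
      simp only [Pi.add_apply, Pi.smul_apply, smul_eq_mul, Rat.cast_add, Rat.cast_mul,
        Rat.cast_neg, add_mul, mul_assoc, Finset.sum_add_distrib, ← Finset.mul_sum] at h
      simp only [ht]
      rw [div_lt_iff₀ hfx', div_mul_eq_mul_div, lt_div_iff_of_neg hgx']
      linarith)
  refine ⟨z, fun f hf => ?_⟩
  rcases lt_trichotomy (f x) 0 with h | h | h
  · have h1 := hhi _ (Finset.mem_image_of_mem t
      (Finset.mem_filter.2 ⟨hfin.mem_toFinset.2 hf, h⟩))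
    have h' : (f x : ℝ) < 0 := by exact_mod_cast h
    simp only [ht] at h1
    rw [lt_div_iff_of_neg h'] at h1
    linarith
  · simpa [h] using hF f (Or.inl ⟨hf, h⟩)
  · have h1 := hlo _ (Finset.mem_image_of_mem t
      (Finset.mem_filter.2 ⟨hfin.mem_toFinset.2 hf, h⟩))
    have h' : (0 : ℝ) < f x := by exact_mod_cast h
    simp only [ht] at h1
    rw [div_lt_iff₀ h'] at h1
    linarith

/-! ### Realizing positive linear forms at scaled powers -/

/-- Finitely many linear forms that are positive at `v` remain positive when each `v i` is replaced
by a power of the base `b (col i)`, scaled by a positive real that depends only on the base. The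
forms are given by their coefficients, of which only those on `S` matter. -/
theorem exists_scaled_powers {V I : Type*} [AddCommGroup V] [LinearOrder V]
    [IsOrderedAddMonoid V] [Module ℚ V] [IsStrictOrderedModule ℚ V] {b : Bool → ℝ}
    (hb : ∀ c, 1 < b c)
    (hdense : ∀ c c', c ≠ c' → ∀ r : ℝ, 0 < r → ∃ D E : ℕ → ℕ, Tendsto D atTop atTop ∧
      Tendsto E atTop atTop ∧ Tendsto (fun n => b c' ^ E n / b c ^ D n) atTop (𝓝 r))
    (col : I → Bool) (v : I → V) (S : Finset I) (F : Set (I → ℚ)) (hF : F.Finite)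
    (hv : ∀ i ∈ S, 0 < v i)
    (hS : ∀ i ∈ S, ∀ j ∈ S, i ≠ j → col i = col j →
      ArchimedeanClass.mk (v i) ≠ ArchimedeanClass.mk (v j))
    (hpos : ∀ f ∈ F, 0 < ∑ i ∈ S, f i • v i) :
    ∃ (σ : I → ℕ) (θ : Bool → ℝ), (∀ c, 0 < θ c) ∧
      ∀ f ∈ F, 0 < ∑ i ∈ S, (f i : ℝ) * (θ (col i) * b (col i) ^ σ i) := by
  classical
  induction S using Finset.strongInduction generalizing F with
  | H S ih =>
  rcases S.eq_empty_or_nonempty with rfl | hne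
  · exact ⟨fun _ => 0, fun _ => 1, fun _ => one_pos, fun f hf => by simpa using hpos f hf⟩
  obtain ⟨x, hx, hxmax⟩ := S.exists_max_image v hne
  have hle : ∀ i ∈ S, ArchimedeanClass.mk (v x) ≤ ArchimedeanClass.mk (v i) := fun i hi =>
    ArchimedeanClass.mk_antitoneOn (hv i hi).le (hv x hx).le (hxmax i hi)
  by_cases hy : ∃ y ∈ S, y ≠ x ∧ ArchimedeanClass.mk (v y) = ArchimedeanClass.mk (v x)
  · -- two elements `x`, `y` in the top class
    obtain ⟨y, hyS, hyx, hmk⟩ := hy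
    have hcol : col x ≠ col y := fun h => hS y hyS x hx hyx h.symm hmk
    set S' := (S.erase x).erase y with hS'
    have hyS1 : y ∈ S.erase x := Finset.mem_erase.2 ⟨hyx, hyS⟩
    have hS'S : S' ⊆ S := (Finset.erase_subset _ _).trans (Finset.erase_subset _ _)
    have hmem : ∀ i ∈ S', i ≠ y ∧ i ≠ x := fun i hi => by
      simp only [hS', Finset.mem_erase] at hi
      exact ⟨hi.1, hi.2.1⟩
    have hsplitV : ∀ f : I → ℚ, ∑ i ∈ S, f i • v i
        = f x • v x + f y • v y + ∑ i ∈ S', f i • v i := fun f => by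
      rw [← Finset.add_sum_erase S _ hx, ← Finset.add_sum_erase _ _ hyS1, add_assoc]
    have hsplitR : ∀ w : I → ℝ, ∑ i ∈ S, w i = w x + w y + ∑ i ∈ S', w i := fun w => by
      rw [← Finset.add_sum_erase S _ hx, ← Finset.add_sum_erase _ _ hyS1, add_assoc]
    have hlt : ∀ i ∈ S', ArchimedeanClass.mk (v y) < ArchimedeanClass.mk (v i) := by
      intro i hi
      obtain ⟨hiy, hix⟩ := hmem i hi
      have hiS := hS'S hi
      rw [hmk]
      refine lt_of_le_of_ne (hle i hiS) fun h => ?_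
      by_cases hc : col i = col x
      · exact hS i hiS x hx hix hc h.symm
      · have hc' : col i = col y := by
          revert hc hcol
          cases col i <;> cases col x <;> cases col y <;> simp
        exact hS i hiS y hyS hiy hc' (h.symm.trans hmk.symm)
    obtain ⟨ρ, hρ, hlead⟩ := exists_leading_ratio (hv x hx) (hv y hyS) hmk.symm
    have hlead' : ∀ f ∈ F, (0 : ℝ) ≤ f x * ρ + f y := fun f hf =>
      hlead _ _ _ (mk_lt_mk_sum (hv y hyS).ne' S' f v hlt) (hsplitV f ▸ hpos f hf)
    set G : Set (I → ℚ) := {f | f ∈ F ∧ (f x * ρ + f y : ℝ) = 0} with hG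
    -- the forms in `G` depend on `v x`, `v y` only through `z = v x - ρ * v y`
    obtain ⟨z, hz⟩ : ∃ z : V, ∀ f ∈ G, f x • v x + f y • v y = f x • z := by
      by_cases hq : ∃ q : ℚ, (q : ℝ) = ρ
      · obtain ⟨q, rfl⟩ := hq
        refine ⟨v x - q • v y, fun f hf => ?_⟩
        have h : f x * q + f y = 0 := by exact_mod_cast hf.2
        rw [eq_neg_of_add_eq_zero_right h, smul_sub, smul_smul, neg_smul, sub_eq_add_neg]
      · refine ⟨0, fun f hf => ?_⟩
        -- `ρ` is irrational here, so `f x * ρ + f y = 0` forces both coefficients to vanish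
        have hfx : f x = 0 := by
          by_contra hne
          have hne' : (f x : ℝ) ≠ 0 := by exact_mod_cast hne
          refine hq ⟨-f y / f x, ?_⟩
          push_cast
          rw [div_eq_iff hne']
          linarith [hf.2]
        have hfy : f y = 0 := by
          have := hf.2
          rw [hfx] at this
          simpa using this
        simp [hfx, hfy]
    have hGfin : G.Finite := hF.subset fun f hf => hf.1
    have hGpos : ∀ f ∈ G, 0 < f x • z + ∑ i ∈ S', f i • v i := fun f hf => by
      rw [← hz f hf, ← hsplitV]
      exact hpos f hf.1
    obtain ⟨σ, θ, hθ, hσ⟩ := ih S' (lt_of_le_of_lt (Finset.erase_subset _ _)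
      (Finset.erase_ssubset hx)) (eliminate G x) (eliminate_finite hGfin x)
      (fun i hi => hv i (hS'S hi)) (fun i hi j hj => hS i (hS'S hi) j (hS'S hj))
      (fun f hf => eliminate_pos hGpos hf)
    obtain ⟨z₀, hz₀⟩ := exists_of_eliminate_pos hGfin hσ
    obtain ⟨D, E, hD, hE, hDE⟩ := hdense (col x) (col y) hcol (θ (col x) / (ρ * θ (col y)))
      (div_pos (hθ _) (mul_pos hρ (hθ _)))
    have hb0 : ∀ c, b c ≠ 0 := fun c => (zero_lt_one.trans (hb c)).ne'
    have hpowD : Tendsto (fun n => b (col x) ^ D n) atTop atTop :=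
      (tendsto_pow_atTop_atTop_of_one_lt (hb _)).comp hD
    have hpowE : Tendsto (fun n => b (col y) ^ E n) atTop atTop :=
      (tendsto_pow_atTop_atTop_of_one_lt (hb _)).comp hE
    -- the scaling factor for which `x - ρ y` takes the value `z₀` exactly
    set t : ℕ → ℝ := fun n => (z₀ + ρ * θ (col y) * b (col y) ^ E n) / b (col x) ^ D n with ht
    have htlim : Tendsto t atTop (𝓝 (θ (col x))) := by
      have h1 := (hpowD.inv_tendsto_atTop.const_mul z₀).add (hDE.const_mul (ρ * θ (col y)))
      rw [mul_zero, zero_add, mul_div_cancel₀ _ (mul_pos hρ (hθ _)).ne'] at h1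
      refine h1.congr fun n => ?_
      simp only [ht, Pi.inv_apply]
      ring
    set θ' : ℕ → Bool → ℝ := fun n => Function.update θ (col x) (t n) with hθ'
    have hθ'lim : ∀ c, Tendsto (fun n => θ' n c) atTop (𝓝 (θ c)) := by
      intro c
      by_cases hc : c = col x
      · subst hc
        simpa [hθ'] using htlim
      · simp [hθ', Function.update_of_ne hc]
    set σ' : ℕ → I → ℕ := fun n => Function.update (Function.update σ y (E n)) x (D n) with hσ'
    have hrest : ∀ f : I → ℚ, Tendsto
        (fun n => ∑ i ∈ S', (f i : ℝ) * (θ' n (col i) * b (col i) ^ σ i)) atTop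
        (𝓝 (∑ i ∈ S', (f i : ℝ) * (θ (col i) * b (col i) ^ σ i))) := fun f =>
      tendsto_finsetSum _ fun i _ => ((hθ'lim _).mul_const _).const_mul _
    have hval : ∀ (f : I → ℚ) (n : ℕ),
        ∑ i ∈ S, (f i : ℝ) * (θ' n (col i) * b (col i) ^ σ' n i)
          = (f x * ρ + f y) * (θ (col y) * b (col y) ^ E n)
            + (f x * z₀ + ∑ i ∈ S', (f i : ℝ) * (θ' n (col i) * b (col i) ^ σ i)) := by
      intro f n
      rw [hsplitR]
      have h1 : ∑ i ∈ S', (f i : ℝ) * (θ' n (col i) * b (col i) ^ σ' n i)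
          = ∑ i ∈ S', (f i : ℝ) * (θ' n (col i) * b (col i) ^ σ i) :=
        Finset.sum_congr rfl fun i hi => by
          simp only [hσ', Function.update_of_ne (hmem i hi).2, Function.update_of_ne (hmem i hi).1]
      have h2 : θ' n (col x) * b (col x) ^ σ' n x = z₀ + ρ * θ (col y) * b (col y) ^ E n := by
        simp only [hθ', hσ', Function.update_self, ht]
        exact div_mul_cancel₀ _ (pow_ne_zero _ (hb0 _))
      have h3 : θ' n (col y) * b (col y) ^ σ' n y = θ (col y) * b (col y) ^ E n := by
        simp only [hθ', hσ', Function.update_self, Function.update_of_ne hyx,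
          Function.update_of_ne hcol.symm]
      rw [h1, h2, h3]
      ring
    have hev : ∀ f ∈ F, ∀ᶠ n in atTop,
        0 < ∑ i ∈ S, (f i : ℝ) * (θ' n (col i) * b (col i) ^ σ' n i) := by
      intro f hf
      simp only [hval]
      rcases (hlead' f hf).eq_or_lt with h0 | h0
      · have h1 := (hrest f).const_add ((f x : ℝ) * z₀)
        simp only [← h0, zero_mul, zero_add]
        exact h1.eventually (lt_mem_nhds (hz₀ f ⟨hf, h0.symm⟩))
      · exact (((hpowE.const_mul_atTop (hθ _)).const_mul_atTop h0).atTop_add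
          ((hrest f).const_add _)).eventually_gt_atTop 0
    obtain ⟨n, hn, htn⟩ := (((eventually_all_finite hF).2 hev).and
      (htlim.eventually (lt_mem_nhds (hθ _)))).exists
    refine ⟨σ' n, θ' n, fun c => ?_, hn⟩
    by_cases hc : c = col x
    · subst hc
      simpa [hθ'] using htn
    · simpa [hθ', Function.update_of_ne hc] using hθ c
  · -- `x` is alone in the top class
    push Not at hy
    set S' := S.erase x with hS'
    have hlt : ∀ i ∈ S', ArchimedeanClass.mk (v x) < ArchimedeanClass.mk (v i) := fun i hi =>
      lt_of_le_of_ne (hle i (Finset.mem_of_mem_erase hi))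
        (hy i (Finset.mem_of_mem_erase hi) (Finset.ne_of_mem_erase hi)).symm
    have hfx : ∀ f ∈ F, 0 ≤ f x := fun f hf =>
      nonneg_of_pos_smul_add (hv x hx) (mk_lt_mk_sum (hv x hx).ne' S' f v hlt)
        (by rw [Finset.add_sum_erase S (fun i => f i • v i) hx]; exact hpos f hf)
    obtain ⟨σ, θ, hθ, hσ⟩ := ih S' (Finset.erase_ssubset hx) {f | f ∈ F ∧ f x = 0}
      (hF.subset fun f hf => hf.1) (fun i hi => hv i (Finset.mem_of_mem_erase hi))
      (fun i hi j hj => hS i (Finset.mem_of_mem_erase hi) j (Finset.mem_of_mem_erase hj))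
      (fun f hf => by
        have := hpos f hf.1
        rwa [← Finset.add_sum_erase S _ hx, hf.2, zero_smul, zero_add] at this)
    have hval : ∀ (f : I → ℚ) (n : ℕ),
        ∑ i ∈ S, (f i : ℝ) * (θ (col i) * b (col i) ^ Function.update σ x n i)
          = f x * (θ (col x) * b (col x) ^ n)
            + ∑ i ∈ S', (f i : ℝ) * (θ (col i) * b (col i) ^ σ i) := by
      intro f n
      rw [← Finset.add_sum_erase S _ hx, Function.update_self]
      congr 1
      exact Finset.sum_congr rfl fun i hi => by
        rw [Function.update_of_ne (Finset.ne_of_mem_erase hi)]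
    have hev : ∀ f ∈ F, ∀ᶠ n in atTop,
        0 < ∑ i ∈ S, (f i : ℝ) * (θ (col i) * b (col i) ^ Function.update σ x n i) := by
      intro f hf
      simp only [hval]
      rcases (hfx f hf).eq_or_lt with h0 | h0
      · simp only [← h0, Rat.cast_zero, zero_mul, zero_add]
        exact Eventually.of_forall fun _ => hσ f ⟨hf, h0.symm⟩
      · have h0' : (0 : ℝ) < f x := by exact_mod_cast h0
        exact ((((tendsto_pow_atTop_atTop_of_one_lt (hb _)).const_mul_atTop
          (hθ _)).const_mul_atTop h0').atTop_add tendsto_const_nhds).eventually_gt_atTop 0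
    obtain ⟨n, hn⟩ := ((eventually_all_finite hF).2 hev).exists
    exact ⟨_, θ, hθ, hn⟩

/-- The scaling factors of `exists_scaled_powers` can be absorbed into the powers, since by density
they are approximated, up to a common factor, by powers of the bases. -/
theorem exists_powers {V I : Type*} [AddCommGroup V] [LinearOrder V]
    [IsOrderedAddMonoid V] [Module ℚ V] [IsStrictOrderedModule ℚ V] {b : Bool → ℝ}
    (hb : ∀ c, 1 < b c)
    (hdense : ∀ c c', c ≠ c' → ∀ r : ℝ, 0 < r → ∃ D E : ℕ → ℕ, Tendsto D atTop atTop ∧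
      Tendsto E atTop atTop ∧ Tendsto (fun n => b c' ^ E n / b c ^ D n) atTop (𝓝 r))
    (col : I → Bool) (v : I → V) (S : Finset I) (F : Set (I → ℚ)) (hF : F.Finite)
    (hv : ∀ i ∈ S, 0 < v i)
    (hS : ∀ i ∈ S, ∀ j ∈ S, i ≠ j → col i = col j →
      ArchimedeanClass.mk (v i) ≠ ArchimedeanClass.mk (v j))
    (hpos : ∀ f ∈ F, 0 < ∑ i ∈ S, f i • v i) :
    ∃ σ : I → ℕ, ∀ f ∈ F, 0 < ∑ i ∈ S, (f i : ℝ) * b (col i) ^ σ i := by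
  obtain ⟨σ, θ, hθ, hσ⟩ := exists_scaled_powers hb hdense col v S F hF hv hS hpos
  obtain ⟨D, E, -, -, hDE⟩ := hdense false true (by simp) (θ true / θ false)
    (div_pos (hθ _) (hθ _))
  have hb0 : ∀ c n, 0 < b c ^ n := fun c n => pow_pos (zero_lt_one.trans (hb c)) n
  set s : ℕ → Bool → ℕ := fun n c => cond c (E n) (D n) with hs
  have hlim : ∀ c, Tendsto (fun n => θ false * (b c ^ s n c / b false ^ D n)) atTop
      (𝓝 (θ c)) := by
    intro c
    cases c
    · simp [hs, div_self (hb0 _ _).ne']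
    · simpa [hs, mul_div_cancel₀ _ (hθ false).ne'] using hDE.const_mul (θ false)
  have hev : ∀ f ∈ F, ∀ᶠ n in atTop,
      0 < ∑ i ∈ S, (f i : ℝ) * b (col i) ^ (s n (col i) + σ i) := by
    intro f hf
    have h1 : Tendsto (fun n => ∑ i ∈ S, (f i : ℝ) *
        ((θ false * (b (col i) ^ s n (col i) / b false ^ D n)) * b (col i) ^ σ i)) atTop
        (𝓝 (∑ i ∈ S, (f i : ℝ) * (θ (col i) * b (col i) ^ σ i))) :=
      tendsto_finsetSum _ fun i _ => ((hlim _).mul_const _).const_mul _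
    filter_upwards [h1.eventually (lt_mem_nhds (hσ f hf))] with n hn
    have h2 : ∑ i ∈ S, (f i : ℝ) *
        ((θ false * (b (col i) ^ s n (col i) / b false ^ D n)) * b (col i) ^ σ i)
        = (θ false / b false ^ D n) * ∑ i ∈ S, (f i : ℝ) * b (col i) ^ (s n (col i) + σ i) := by
      rw [Finset.mul_sum]
      refine Finset.sum_congr rfl fun i _ => ?_
      rw [pow_add]
      ring
    rw [h2] at hn
    exact pos_of_mul_pos_right hn (div_pos (hθ _) (hb0 _ _)).le
  obtain ⟨n, hn⟩ := ((eventually_all_finite hF).2 hev).exists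
  exact ⟨_, hn⟩

/-! ### Orbits and residues of nonstandard powers -/

/-- Two elements of `A b` are in the same orbit under multiplication by powers of `b`, or one is
infinitely larger than the other. -/
theorem eq_pow_smul_or_nsmul_lt {M : Type*} [AddCommGroup M] [LinearOrder M]
    [IsOrderedAddMonoid M] {L : Set ℕ} {A : ℕ → Set M} (hA : BasicInequalityAxioms L A) {b : ℕ}
    (hbL : b ∈ L) (hb : 2 ≤ b) (hmul : ∀ x ∈ A b, b • x ∈ A b) {x y : M} (hx : x ∈ A b)
    (hy : y ∈ A b) (hxy : x ≤ y) :
    (∃ e : ℕ, y = (b ^ e) • x) ∨ ∀ n : ℕ, n • x < y := by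
  by_contra! h
  obtain ⟨hne, n, hn⟩ := h
  have key : ∀ e : ℕ, (b ^ e) • x ∈ A b ∧ (b ^ e) • x < y := by
    intro e
    induction e with
    | zero => exact ⟨by simpa using hx, lt_of_le_of_ne (by simpa using hxy) (hne 0).symm⟩
    | succ e ih =>
      have hsucc : (b ^ (e + 1)) • x = b • (b ^ e) • x := by rw [pow_succ', mul_smul]
      refine ⟨hsucc ▸ hmul _ ih.1, lt_of_le_of_ne ?_ (hne _).symm⟩
      by_contra! hlt
      exact (hA b hbL _ ih.1).2 y hy ⟨ih.2, hsucc ▸ hlt⟩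
  have h1 : n • x ≤ (b ^ n) • x :=
    nsmul_le_nsmul_left (hA b hbL x hx).1.le (Nat.lt_pow_self (by omega)).le
  exact absurd (hn.trans h1) (not_le.2 (key n).2)

/-- A finite preorder is covered from below by a set of pairwise unrelated elements: take a minimal
set `S` such that every element lies above one of `S`. -/
theorem exists_kernel {J : Type*} [Finite J] (R : J → J → Prop) (hrefl : ∀ i, R i i)
    (htrans : ∀ i j k, R i j → R j k → R i k) :
    ∃ S : Finset J, (∀ j, ∃ i ∈ S, R i j) ∧ ∀ i ∈ S, ∀ j ∈ S, i ≠ j → ¬ R i j := by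
  classical
  have := Fintype.ofFinite J
  obtain ⟨S, hS⟩ := exists_minimal_of_wellFoundedLT (fun S : Finset J => ∀ j, ∃ i ∈ S, R i j)
    ⟨Finset.univ, fun j => ⟨j, Finset.mem_univ j, hrefl j⟩⟩
  refine ⟨S, hS.prop, fun i hi j hj hij hR => ?_⟩
  refine hS.not_prop_of_lt (Finset.erase_ssubset hj) fun t => ?_
  obtain ⟨s, hs, hst⟩ := hS.prop t
  by_cases h : s = j
  · subst h
    exact ⟨i, Finset.mem_erase.2 ⟨hij, hi⟩, htrans _ _ _ hR hst⟩
  · exact ⟨s, Finset.mem_erase.2 ⟨h, hs⟩, hst⟩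

/-- Powers are eventually periodic modulo `d`, with the same preperiod and period for finitely many
bases: apply the pigeonhole principle to the tuples of powers. -/
theorem exists_pow_periodic {Γ : Type*} [Finite Γ] (b : Γ → ℕ) (d : ℕ) (hd : 0 < d) :
    ∃ e P : ℕ, 0 < P ∧ ∀ c, ∀ s, e ≤ s → ∀ t,
      (b c : ℤ) ^ (s + P * t) ≡ (b c : ℤ) ^ s [ZMOD d] := by
  have : NeZero d := ⟨hd.ne'⟩
  obtain ⟨i, j, hij, h⟩ := Finite.exists_ne_map_eq_of_infinite
    fun n : ℕ => fun c : Γ => (b c : ZMod d) ^ n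
  wlog hlt : i < j generalizing i j
  · exact this j i hij.symm h.symm (by omega)
  refine ⟨i, j - i, by omega, fun c s hs t => ?_⟩
  induction t with
  | zero => simp [Int.ModEq.refl]
  | succ t ih =>
    refine Int.ModEq.trans ?_ ih
    have hc := congrFun h c
    rw [← ZMod.intCast_eq_intCast_iff]
    push_cast
    have h1 : s + (j - i) * (t + 1) = (s - i + (j - i) * t) + j := by
      rw [mul_add]; omega
    have h2 : s + (j - i) * t = (s - i + (j - i) * t) + i := by omega
    rw [h1, h2, pow_add, ← hc, ← pow_add]

/-- Contrapositive form of the Carmichael axioms, for nonstandard elements, where the exponents can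
be required to be arbitrarily large. -/
theorem CarmichaelAxioms.exists_exponents {M J : Type*} [AddCommGroup M] [One M] [Fintype J]
    {L : Set ℕ} {A : ℕ → Set M} (hA : CarmichaelAxioms L A) {d : ℕ} (hd : 0 < d) (e : ℕ)
    (b : J → ℕ) (x : J → M) (hb : ∀ j, b j ∈ L) (hx : ∀ j, x j ∈ A (b j))
    (hns : ∀ j, ∀ z : ℤ, x j ≠ z • (1 : M)) :
    ∃ s : J → ℕ, (∀ j, e ≤ s j) ∧ ∀ (c : J → ℤ) (g : ℤ),
      D d ((∑ j, c j • x j) + g • (1 : M)) → (d : ℤ) ∣ (∑ j, c j * (b j : ℤ) ^ s j) + g := by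
  obtain ⟨s, hs, h⟩ := hA d e (Fintype.card J) hd (b ∘ (Fintype.equivFin J).symm)
    (x ∘ (Fintype.equivFin J).symm) (fun i => hb _) (fun i => hx _)
    (fun i j _ hij => hns _ ((b ((Fintype.equivFin J).symm i) ^ j : ℕ) : ℤ)
      (by rw [natCast_zsmul]; exact hij))
  refine ⟨s ∘ Fintype.equivFin J, fun j => (hs _).1, fun c g hD => ?_⟩
  by_contra hdvd
  refine h (c ∘ (Fintype.equivFin J).symm) g ?_ ?_
  · rw [← Equiv.sum_comp (Fintype.equivFin J)]
    simpa using hdvd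
  · rw [← Equiv.sum_comp (Fintype.equivFin J)]
    simpa using hD

theorem D.mul_left {M : Type*} [AddCommGroup M] [One M] {J : Type*} [Fintype J] {n : ℕ}
    {c : J → ℤ} {x : J → M} {g : ℤ} (q : ℕ) (h : D n ((∑ j, c j • x j) + g • (1 : M))) :
    D (q * n) ((∑ j, (q * c j) • x j) + (q * g) • (1 : M)) := by
  obtain ⟨y, hy⟩ := h
  refine ⟨y, ?_⟩
  rw [mul_smul q n y, ← hy, smul_add, Finset.smul_sum]
  simp only [mul_smul, natCast_zsmul]

theorem irrational_log_div_log {k l : ℕ} (hk : 2 ≤ k) (hl : 2 ≤ l)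
    (hindep : ∀ a b : ℕ, k ^ a = l ^ b → a = 0 ∧ b = 0) :
    Irrational (Real.log k / Real.log l) := by
  have hk0 : 0 < Real.log k := Real.log_pos (by exact_mod_cast hk)
  have hl0 : 0 < Real.log l := Real.log_pos (by exact_mod_cast hl)
  rintro ⟨q, hq⟩
  have hq0 : 0 < q := by
    have : (0 : ℝ) < q := hq ▸ div_pos hk0 hl0
    exact_mod_cast this
  have hnum : (q.num.toNat : ℤ) = q.num := Int.toNat_of_nonneg (Rat.num_nonneg.2 hq0.le)
  have hqd : (q : ℝ) * q.den = q.num.toNat := by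
    have h1 : ((q * q.den : ℚ) : ℝ) = ((q.num : ℚ) : ℝ) := by rw [Rat.mul_den_eq_num]
    rw [← hnum] at h1
    exact_mod_cast h1
  have hlog : Real.log ((k : ℝ) ^ q.den) = Real.log ((l : ℝ) ^ q.num.toNat) := by
    rw [Real.log_pow, Real.log_pow, ← hqd, hq]
    field_simp
  have hpow : (k : ℝ) ^ q.den = (l : ℝ) ^ q.num.toNat :=
    Real.log_injOn_pos (Set.mem_Ioi.2 (by positivity)) (Set.mem_Ioi.2 (by positivity)) hlog
  exact q.den_ne_zero (hindep _ _ (by exact_mod_cast hpow)).1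

theorem archimedeanClass_coe_lt {M : Type*} [AddCommGroup M] [LinearOrder M]
    [IsOrderedAddMonoid M] {x y : M} (hx : 0 < x) (h : ∀ n : ℕ, n • x < y) :
    ArchimedeanClass.mk (y : DivisibleHull M) < ArchimedeanClass.mk (x : DivisibleHull M) := by
  have hcoe : StrictMono (DivisibleHull.coeOrderAddMonoidHom M) :=
    (DivisibleHull.coeOrderAddMonoidHom M).monotone'.strictMono_of_injective
      DivisibleHull.coe_injective
  have hx' : 0 < DivisibleHull.coeOrderAddMonoidHom M x := by
    simpa only [map_zero] using hcoe hx
  have hy' : 0 < DivisibleHull.coeOrderAddMonoidHom M y := by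
    simpa only [map_zero] using hcoe (show 0 < y by simpa using h 0)
  rw [ArchimedeanClass.mk_lt_mk]
  intro n
  have := hcoe (h n)
  rw [map_nsmul] at this
  rwa [← abs_of_pos hx', ← abs_of_pos hy'] at this

/-! ### Solutions in standard powers -/

/-- The transfer from a model to `ℤ`, with both families of nonstandard powers indexed by one type
`J`, where `col j` selects the base of the `j`-th element. -/
theorem exists_standard_solution {M J : Type*} [AddCommGroup M] [LinearOrder M]
    [IsOrderedAddMonoid M] [One M] [Fintype J] {base : Bool → ℕ} (hbase : ∀ c, 2 ≤ base c)
    (hirr : ∀ c c', c ≠ c' → Irrational (Real.log (base c) / Real.log (base c')))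
    {L : Set ℕ} (hL : ∀ c, base c ∈ L) {A : ℕ → Set M}
    (hmul : ∀ c, ∀ x ∈ A (base c), base c • x ∈ A (base c))
    (hineq : BasicInequalityAxioms L A) (hcar : CarmichaelAxioms L A)
    {r : Type*} [Finite r] (C : Matrix r J ℚ) (col : J → Bool) (x : J → M)
    (hx : ∀ j, x j ∈ A (base (col j))) (hns : ∀ j, ∀ z : ℤ, x j ≠ z • (1 : M))
    (hC : SolvesStrict C x) {Δ : Set (DivCond J)} (hfin : Δ.Finite)
    (hΔ : Δ ⊆ congruenceType x) :
    ∃ s : J → ℕ, (∀ a, 0 < ∑ j, C a j * (base (col j) : ℚ) ^ s j) ∧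
      ∀ φ ∈ Δ, φ.Holds fun j => (base (col j) : ℤ) ^ s j := by
  classical
  have hpos : ∀ j, 0 < x j := fun j => (hineq _ (hL _) _ (hx j)).1
  have hbpos : ∀ c, 0 < base c := fun c => by have := hbase c; omega
  -- representatives of the orbits under multiplication by powers of the base
  obtain ⟨S, hcover, hS⟩ := exists_kernel
    (fun i j => col i = col j ∧ ∃ e : ℕ, x j = (base (col j) ^ e) • x i)
    (fun i => ⟨rfl, 0, by simp⟩)
    (by
      rintro i j t ⟨hij, e, he⟩ ⟨hjt, e', he'⟩
      exact ⟨hij.trans hjt, e' + e, by rw [he', he, pow_add, mul_smul, hjt]⟩)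
  choose rep hrepS hcol expo hexpo using hcover
  -- exponents `s` with the residues of the representatives, in the range where powers are periodic
  set d : ℕ := ∏ φ ∈ hfin.toFinset, φ.modulus
  have hd0 : 0 < d := Finset.prod_pos fun φ _ => φ.modulus_pos
  obtain ⟨e, P, hP, hper⟩ := exists_pow_periodic base d hd0
  obtain ⟨s, hse, hs⟩ := hcar.exists_exponents hd0 e (fun j => base (col j)) x
    (fun j => hL _) hx hns
  -- the system in terms of the representatives, rescaled by the powers with the right residues
  set v : J → DivisibleHull M := fun i => ((base (col i) : ℚ) ^ s i)⁻¹ • (x i : DivisibleHull M)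
    with hv
  set f : r → J → ℚ := fun a i =>
    (∑ j with rep j = i, C a j * (base (col j) : ℚ) ^ expo j) * (base (col i) : ℚ) ^ s i with hf
  have hbq : ∀ c n, (0 : ℚ) < (base c : ℚ) ^ n := fun c n =>
    pow_pos (by exact_mod_cast hbpos c) n
  have hcoe : ∀ {y : M}, 0 < y → (0 : DivisibleHull M) < y := fun {y} hy => by
    have : StrictMono (DivisibleHull.coeOrderAddMonoidHom M) :=
      (DivisibleHull.coeOrderAddMonoidHom M).monotone'.strictMono_of_injective
        DivisibleHull.coe_injective
    simpa using this hy
  have hxrep : ∀ j, (x j : DivisibleHull M)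
      = ((base (col j) : ℚ) ^ expo j) • (x (rep j) : DivisibleHull M) := fun j => by
    have h := congrArg (DivisibleHull.coeOrderAddMonoidHom M) (hexpo j)
    rw [map_nsmul] at h
    rw [← Nat.cast_pow, Nat.cast_smul_eq_nsmul]
    exact h
  have hsum : ∀ a, ∑ i ∈ S, f a i • v i = ∑ j, C a j • (x j : DivisibleHull M) := fun a => by
    rw [← Finset.sum_fiberwise_of_maps_to (s := Finset.univ) (t := S) (g := rep)
      (fun j _ => hrepS j)]
    refine Finset.sum_congr rfl fun i _ => ?_
    simp only [hf, hv]
    rw [smul_smul, mul_inv_cancel_right₀ (hbq _ _).ne', Finset.sum_smul]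
    refine Finset.sum_congr rfl fun j hj => ?_
    rw [hxrep j, smul_smul, (Finset.mem_filter.1 hj).2]
  have hdistinct : ∀ i ∈ S, ∀ j ∈ S, i ≠ j → col i = col j →
      ArchimedeanClass.mk (v i) ≠ ArchimedeanClass.mk (v j) := by
    intro i hi j hj hij hc
    simp only [hv]
    rw [ArchimedeanClass.mk_smul _ (inv_ne_zero (hbq _ _).ne'),
      ArchimedeanClass.mk_smul _ (inv_ne_zero (hbq _ _).ne')]
    wlog hle : x i ≤ x j generalizing i j
    · exact (this j hj i hi hij.symm hc.symm (le_of_not_ge hle)).symm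
    rcases eq_pow_smul_or_nsmul_lt hineq (hL (col j)) (hbase _) (hmul _) (hc ▸ hx i) (hx j) hle
      with h | h
    · exact absurd ⟨hc, h⟩ (hS i hi j hj hij)
    · exact (archimedeanClass_coe_lt (hpos i) h).ne'
  obtain ⟨σ, hσ⟩ := exists_powers (b := fun c => (base c : ℝ) ^ P)
    (fun c => one_lt_pow₀ (by exact_mod_cast hbase c) hP.ne')
    (fun c c' hc ρ hρ => exists_tendsto_pow_div_pow
      (one_lt_pow₀ (by exact_mod_cast hbase c) hP.ne')
      (one_lt_pow₀ (by exact_mod_cast hbase c') hP.ne')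
      (by
        rw [Real.log_pow, Real.log_pow, mul_div_mul_left _ _ (by exact_mod_cast hP.ne')]
        exact hirr c c' hc) hρ)
    col v S (Set.range f) (Set.finite_range f)
    (fun i _ => smul_pos (inv_pos.2 (hbq _ _)) (hcoe (hpos i))) hdistinct
    (by
      rintro _ ⟨a, rfl⟩
      rw [hsum]
      exact hC a)
  -- the powers `base ^ (s i + P * σ i)` replace the representatives
  refine ⟨fun j => expo j + (s (rep j) + P * σ (rep j)), fun a => ?_, fun φ hφ => ?_⟩
  · have h := hσ _ ⟨a, rfl⟩
    have h' : (0 : ℚ) < ∑ i ∈ S, f a i * ((base (col i) : ℚ) ^ P) ^ σ i := by exact_mod_cast h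
    convert h' using 1
    rw [← Finset.sum_fiberwise_of_maps_to (s := Finset.univ) (t := S) (g := rep)
      (fun j _ => hrepS j)]
    refine Finset.sum_congr rfl fun i _ => ?_
    simp only [hf]
    rw [mul_assoc, Finset.sum_mul]
    refine Finset.sum_congr rfl fun j hj => ?_
    rw [← (Finset.mem_filter.1 hj).2, hcol j, pow_add, pow_add, pow_mul]
    ring
  · obtain ⟨q, hq⟩ : φ.modulus ∣ d := Finset.dvd_prod_of_mem _ (hfin.mem_toFinset.2 hφ)
    have hq0 : q ≠ 0 := by rintro rfl; simp [hq] at hd0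
    have h1 := D.mul_left q (hΔ hφ)
    rw [mul_comm q, ← hq] at h1
    have h2 := hs (fun i => ∑ j with rep j = i, q * φ.coeff j * (base (col j) : ℤ) ^ expo j)
      (q * φ.const) (by
        convert h1 using 2
        rw [← Finset.sum_fiberwise Finset.univ rep fun j => ((q : ℤ) * φ.coeff j) • x j]
        refine Finset.sum_congr rfl fun i _ => ?_
        rw [Finset.sum_smul]
        refine Finset.sum_congr rfl fun j hj => ?_
        rw [mul_smul, ← (Finset.mem_filter.1 hj).2]
        congr 1
        conv_rhs => rw [hexpo j]
        rw [← natCast_zsmul]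
        push_cast
        rfl)
    have h3 : (∑ i, (∑ j with rep j = i, q * φ.coeff j * (base (col j) : ℤ) ^ expo j)
          * (base (col i) : ℤ) ^ s i) + q * φ.const
        = q * ((∑ j, φ.coeff j * (base (col j) : ℤ) ^ (expo j + s (rep j))) + φ.const) := by
      rw [mul_add, Finset.mul_sum, ← Finset.sum_fiberwise Finset.univ rep
        (fun j => (q : ℤ) * (φ.coeff j * (base (col j) : ℤ) ^ (expo j + s (rep j))))]
      congr 1
      refine Finset.sum_congr rfl fun i _ => ?_
      rw [Finset.sum_mul]
      refine Finset.sum_congr rfl fun j hj => ?_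
      rw [← (Finset.mem_filter.1 hj).2, hcol j, pow_add]
      ring
    rw [h3, hq, Nat.cast_mul, mul_comm (φ.modulus : ℤ)] at h2
    have h4 := Int.dvd_of_mul_dvd_mul_left (by exact_mod_cast hq0) h2
    have h5 : (∑ j, φ.coeff j * (base (col j) : ℤ) ^ (expo j + (s (rep j) + P * σ (rep j))))
          + φ.const
        ≡ (∑ j, φ.coeff j * (base (col j) : ℤ) ^ (expo j + s (rep j))) + φ.const
          [ZMOD φ.modulus] := by
      refine Int.ModEq.add_right _ (Int.ModEq.sum fun j _ => Int.ModEq.mul_left _ ?_)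
      rw [pow_add, pow_add _ (expo j) (s (rep j))]
      refine Int.ModEq.mul_left _ ((hper _ _ (hse _) _).of_dvd ?_)
      rw [hq]
      exact_mod_cast dvd_mul_right _ _
    obtain ⟨y, hy⟩ := (Int.ModEq.dvd_iff h5).2 h4
    exact ⟨y, by simpa [smul_eq_mul] using hy⟩

end PowerTheory

theorem mainTheorem2 {M : Type*} [AddCommGroup M] [LinearOrder M] [IsOrderedAddMonoid M] [One M]
    (k l : ℕ) (hk : 2 ≤ k) (hl : 2 ≤ l)
    (hindep : ∀ a b : ℕ, k ^ a = l ^ b → a = 0 ∧ b = 0)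
    (A : ℕ → Set M) (hM : PowerTheory.ModelsUniversalTheory {k, l} A)
    (r m n : ℕ) (C : Matrix (Fin r) (Fin m ⊕ Fin n) ℚ)
    (α : Fin m → M) (α' : Fin n → M)
    (hα : ∀ i, α i ∈ A k ∧ ∀ z : ℤ, α i ≠ z • (1 : M))
    (hα' : ∀ j, α' j ∈ A l ∧ ∀ z : ℤ, α' j ≠ z • (1 : M))
    (hC : PowerTheory.SolvesStrict C (Sum.elim α α'))
    (Δ : Set (PowerTheory.DivCond (Fin m ⊕ Fin n))) (hΔfin : Δ.Finite)
    (hΔ : Δ ⊆ PowerTheory.congruenceType (Sum.elim α α')) :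
    ∃ (u : Fin m → ℤ) (v : Fin n → ℤ),
      (∀ i, ∃ s : ℕ, u i = (k : ℤ) ^ s) ∧ (∀ j, ∃ t : ℕ, v j = (l : ℤ) ^ t) ∧
      (∀ a, 0 < ∑ i, C a i * ((Sum.elim u v i : ℤ) : ℚ)) ∧
      ∀ φ ∈ Δ, φ.Holds (Sum.elim u v) := by
  have hirr := PowerTheory.irrational_log_div_log hk hl hindep
  have hL : ∀ c, cond c k l ∈ ({k, l} : Set ℕ) := by rintro (_ | _) <;> simp
  obtain ⟨s, hpos, hdiv⟩ := PowerTheory.exists_standard_solution (base := fun c => cond c k l)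
    (by rintro (_ | _) <;> assumption)
    (by
      rintro (_ | _) (_ | _) hc
      · exact absurd rfl hc
      · simpa using hirr.inv
      · exact hirr
      · exact absurd rfl hc)
    hL (fun c x => (hM.mul_mem_iff _ (hL c) x).1) hM.basicInequality hM.carmichael C Sum.isLeft
    (Sum.elim α α')
    (by rintro (i | j); exacts [(hα i).1, (hα' j).1])
    (by rintro (i | j); exacts [(hα i).2, (hα' j).2])
    hC hΔfin hΔ
  have hu : (fun j => ((cond (Sum.isLeft j) k l : ℕ) : ℤ) ^ s j)
      = Sum.elim (fun i => (k : ℤ) ^ s (Sum.inl i)) fun j => (l : ℤ) ^ s (Sum.inr j) := by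
    funext j
    cases j <;> rfl
  refine ⟨fun i => (k : ℤ) ^ s (Sum.inl i), fun j => (l : ℤ) ^ s (Sum.inr j), fun i => ⟨_, rfl⟩,
    fun j => ⟨_, rfl⟩, fun a => ?_, fun φ hφ => hu ▸ hdiv φ hφ⟩
  rw [← hu]
  exact_mod_cast hpos a
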